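/- **Setting.** Let $\Xi$ be a Cantor space (non-empty, compact, metrizable, totally disconnected, without isolated points) with a fixed ultrametric $d$ inducing its topology. Graphs are simple, undirected and connected, with finite vertex degrees, and carry the path metric; $D_X(x,R)$ is the closed ball with its induced graph structure. A colored graph $(X,\phi)$ is such a graph with a map $\phi\colon X\to\Xi$ on its vertices. Let $\widehat{\mathcal G}_*$ be the set of isomorphism classes $[X,x,\phi]$ of pointed colored graphs. Two pointed colored graphs $(X,x,\phi)$, $(Y,y,\psi)$ are $(R,\epsilon)$-equivalent if there is a graph isomorphism $h\colon D_X(x,R)\to D_Y(y,R)$ with $h(x)=y$ and $d(\phi(u),\psi(h(u)))<\epsilon$ for all $u\in D_X(x,R)$. The space $\widehat{\mathcal G}_*$ carries the topology of the uniformity with base of entourages $\{(p,q)\mid p,q \text{ are } (R,1/R)\text{-equivalent}\}$, $R=1,2,3,\dots$. Let $\mathcal G_*$ be the analogous space of classes $[X,x]$ of pointed graphs, obtained by removing the colorings everywhere. The superscript $\infty$ denotes the subspace of classes whose underlying graph is infinite, and $(\Delta)$, for $\Delta\in\mathbb N=\{0,1,2,\dots\}$, the subspace of those whose underlying graph has all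 vertex degrees $\le\Delta$. For a colored graph put $[X,\phi]=\{[X,x,\phi]\mid x\in X\}\subset\widehat{\mathcal G}_*$. Then $(X,\phi)$ is *quasi-transitive* if $[X,\phi]$ is finite; *almost chaotic* if the classes of quasi-transitive colored graphs lying in the closure $\overline{[X,\phi]}$ are dense in $\overline{[X,\phi]}$; *aperiodic* if its only color-preserving automorphism is the identity; *chaotic* if it is almost chaotic, aperiodic and not quasi-transitive. A class $[X,x,\phi]$ has one of these properties if $(X,\phi)$ does; for uncolored graphs, quasi-transitive and almost chaotic are defined in the same way. A subset of a space is *generic* if it contains a countable intersection of open dense subsets of that space. **Theorem.** (a) The almost chaotic classes are generic in $\mathcal G_*^\infty$ and in $\widehat{\mathcal G}_*^\infty$, and, for every $\Delta\ge 3$, in $\mathcal G_*^\infty(\Delta)$ and in $\widehat{\mathcal G}_*^\infty(\Delta)$. (b) The aperiodic classes are generic in $\widehat{\mathcal G}_*^\infty$ and, for every $\Delta\in\mathbb N$, in $\widehat{\mathcal G}_*^\infty(\Delta)$. (c) The chaotic classes are generic in $\widehat{\mathcal G}_*^\infty$ and, for every $\Delta\ge 3$, in $\widehat{\mathcal G}_*^\infty(\Delta)$.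 -/

import Mathlib

/-- A connected simple graph with finite vertex degrees and a vertex colouring with values in `C`.
Such a graph is countable, so vertex sets in `Type` represent all isomorphism classes. -/
structure ColoredGraph (C : Type*) where
  V : Type
  graph : SimpleGraph V
  connected : graph.Connected
  finite_neighborSet : ∀ v, (graph.neighborSet v).Finite
  color : V → C

/-- A pointed coloured graph `(X, x, φ)`. -/
structure PointedColoredGraph (C : Type*) extends ColoredGraph C where
  base : V

namespace ColoredGraph

variable {C : Type*}

/-- `deg X ≤ Δ`. -/
def DegreeLE (X : ColoredGraph C) (Δ : ℕ) : Prop :=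
  ∀ v, (X.graph.neighborSet v).ncard ≤ Δ

/-- The automorphism group of `(X, φ)` is trivial. -/
def Aperiodic (X : ColoredGraph C) : Prop :=
  ∀ f : X.graph ≃g X.graph, (∀ v, X.color (f v) = X.color v) → ∀ v, f v = v

end ColoredGraph

namespace PointedColoredGraph

variable {C : Type*}

/-- The disk of radius `R` around the base point, for the path metric. -/
def disk (X : PointedColoredGraph C) (R : ℕ) : Set X.V :=
  {v | X.graph.dist X.base v ≤ R}

theorem base_mem_disk (X : PointedColoredGraph C) (R : ℕ) : X.base ∈ X.disk R := by
  simp [disk]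

/-- There is an isomorphism of pointed coloured graphs from `X` to `Y`. -/
def IsIso (X Y : PointedColoredGraph C) : Prop :=
  ∃ f : X.graph ≃g Y.graph, f X.base = Y.base ∧ ∀ v, Y.color (f v) = X.color v

theorem IsIso.refl (X : PointedColoredGraph C) : IsIso X X :=
  ⟨SimpleGraph.Iso.refl, rfl, fun _ => rfl⟩

theorem IsIso.symm {X Y : PointedColoredGraph C} : IsIso X Y → IsIso Y X := by
  rintro ⟨f, hb, hc⟩
  refine ⟨f.symm, ?_, fun v => ?_⟩
  · rw [← hb]; exact f.symm_apply_apply _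
  · rw [← hc]; exact congrArg _ (f.apply_symm_apply v)

theorem IsIso.trans {X Y Z : PointedColoredGraph C} : IsIso X Y → IsIso Y Z → IsIso X Z := by
  rintro ⟨f, hb, hc⟩ ⟨g, hb', hc'⟩
  refine ⟨g.comp f, ?_, fun v => ?_⟩
  · change g (f X.base) = Z.base
    rw [hb, hb']
  · change Z.color (g (f v)) = X.color v
    rw [hc', hc]

instance setoid (C : Type*) : Setoid (PointedColoredGraph C) where
  r := IsIso
  iseqv := ⟨IsIso.refl, IsIso.symm, IsIso.trans⟩

theorem dist_le_of_diskIso {X Y : PointedColoredGraph C} {R : ℕ}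
    (h : X.graph.induce (X.disk R) ≃g Y.graph.induce (Y.disk R))
    (hb : (h ⟨X.base, X.base_mem_disk R⟩ : Y.V) = Y.base) (n : ℕ) :
    ∀ u : X.disk R, X.graph.dist X.base u ≤ n → Y.graph.dist Y.base (h u : Y.V) ≤ n := by
  induction n with
  | zero =>
    rintro ⟨u, hu⟩ hn
    have h0 : X.base = u := X.connected.dist_eq_zero_iff.1 (Nat.le_zero.1 hn)
    subst h0
    rw [hb]; simp
  | succ n ih =>
    rintro ⟨u, hu⟩ hn
    obtain ⟨p, hp⟩ := X.connected.exists_walk_length_eq_dist u X.base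
    cases p with
    | nil => rw [hb]; simp
    | cons hadj q =>
      rename_i w
      rw [SimpleGraph.dist_comm] at hp
      simp only [SimpleGraph.Walk.length_cons] at hp
      have hw : X.graph.dist X.base w ≤ q.length := by
        rw [SimpleGraph.dist_comm]; exact SimpleGraph.dist_le q
      have hu' : X.graph.dist X.base u ≤ R := hu
      have hn' : X.graph.dist X.base u ≤ n + 1 := hn
      have hwR : w ∈ X.disk R := by
        change X.graph.dist X.base w ≤ R
        omega
      have h1 := ih ⟨w, hwR⟩ (by change X.graph.dist X.base w ≤ n; omega)
      have h2 : Y.graph.Adj (h ⟨w, hwR⟩ : Y.V) (h ⟨u, hu⟩ : Y.V) := by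
        have : (X.graph.induce (X.disk R)).Adj ⟨w, hwR⟩ ⟨u, hu⟩ := hadj.symm
        exact h.map_rel_iff.2 this
      have h3 := Y.connected.dist_triangle (u := Y.base) (v := (h ⟨w, hwR⟩ : Y.V))
        (w := (h ⟨u, hu⟩ : Y.V))
      rw [SimpleGraph.dist_eq_one_iff_adj.2 h2] at h3
      omega

section Metric

variable [PseudoMetricSpace C]

/-- `X` and `Y` are `(R, ε)`-equivalent: some pointed isomorphism between the (induced) disks of
radius `R` changes the colours by less than `ε`. -/
def DiskEquiv (R : ℕ) (ε : ℝ) (X Y : PointedColoredGraph C) : Prop :=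
  ∃ h : X.graph.induce (X.disk R) ≃g Y.graph.induce (Y.disk R),
    (h ⟨X.base, X.base_mem_disk R⟩ : Y.V) = Y.base ∧
    ∀ u : X.disk R, dist (X.color (u : X.V)) (Y.color (h u : Y.V)) < ε

theorem DiskEquiv.symm {R : ℕ} {ε : ℝ} {X Y : PointedColoredGraph C} :
    DiskEquiv R ε X Y → DiskEquiv R ε Y X := by
  rintro ⟨h, hb, hc⟩
  refine ⟨h.symm, ?_, fun u => ?_⟩
  · have : (⟨Y.base, Y.base_mem_disk R⟩ : Y.disk R) = h ⟨X.base, X.base_mem_disk R⟩ :=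
      Subtype.ext hb.symm
    rw [this]
    exact congrArg Subtype.val (h.symm_apply_apply _)
  · have := hc (h.symm u)
    rw [dist_comm]
    rwa [show h (h.symm u) = u from h.apply_symm_apply u] at this

theorem DiskEquiv.mono {r R : ℕ} {δ ε : ℝ} (hr : r ≤ R) (hδ : δ ≤ ε)
    {X Y : PointedColoredGraph C} : DiskEquiv R δ X Y → DiskEquiv r ε X Y := by
  rintro ⟨h, hb, hc⟩
  obtain hb' : (h.symm ⟨Y.base, Y.base_mem_disk R⟩ : X.V) = X.base := by
    have : (⟨Y.base, Y.base_mem_disk R⟩ : Y.disk R) = h ⟨X.base, X.base_mem_disk R⟩ :=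
      Subtype.ext hb.symm
    rw [this]
    exact congrArg Subtype.val (h.symm_apply_apply _)
  have hX : X.disk r ⊆ X.disk R := fun v hv => le_trans hv hr
  have hY : Y.disk r ⊆ Y.disk R := fun v hv => le_trans hv hr
  refine ⟨⟨⟨fun u => ⟨(h ⟨u, hX u.2⟩ : Y.V), dist_le_of_diskIso h hb r ⟨u, hX u.2⟩ u.2⟩,
    fun u => ⟨(h.symm ⟨u, hY u.2⟩ : X.V), dist_le_of_diskIso h.symm hb' r ⟨u, hY u.2⟩ u.2⟩,
    fun u => Subtype.ext ?_, fun u => Subtype.ext ?_⟩, ?_⟩, hb, fun u => ?_⟩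
  · exact congrArg (fun w : X.disk R => (w : X.V)) (h.symm_apply_apply ⟨u, hX u.2⟩)
  · exact congrArg (fun w : Y.disk R => (w : Y.V)) (h.apply_symm_apply ⟨u, hY u.2⟩)
  · intro a b
    exact h.map_rel_iff (a := ⟨a, hX a.2⟩) (b := ⟨b, hX b.2⟩)
  · exact (hc ⟨u, hX u.2⟩).trans_le hδ

theorem DiskEquiv.trans {R : ℕ} {δ ε : ℝ} {X Y Z : PointedColoredGraph C} :
    DiskEquiv R δ X Y → DiskEquiv R ε Y Z → DiskEquiv R (δ + ε) X Z := by
  rintro ⟨h, hb, hc⟩ ⟨k, kb, kc⟩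
  refine ⟨k.comp h, ?_, fun u => ?_⟩
  · change (k (h ⟨X.base, _⟩) : Z.V) = Z.base
    rw [show h ⟨X.base, X.base_mem_disk R⟩ = ⟨Y.base, Y.base_mem_disk R⟩ from Subtype.ext hb, kb]
  · exact (dist_triangle _ _ _).trans_lt (add_lt_add (hc u) (kc (h u)))

theorem IsIso.diskEquiv {R : ℕ} {ε : ℝ} (hε : 0 < ε) {X Y : PointedColoredGraph C} :
    IsIso X Y → DiskEquiv R ε X Y := by
  rintro ⟨f, hb, hc⟩
  have key : ∀ v, X.graph.dist X.base v = Y.graph.dist Y.base (f v) := by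
    intro v
    rw [← hb]
    apply le_antisymm
    · obtain ⟨p, hp⟩ := Y.connected.exists_walk_length_eq_dist (f X.base) (f v)
      have := SimpleGraph.dist_le (p.map f.symm.toHom)
      rw [SimpleGraph.Walk.length_map, hp] at this
      simpa using this
    · obtain ⟨p, hp⟩ := X.connected.exists_walk_length_eq_dist X.base v
      have := SimpleGraph.dist_le (p.map f.toHom)
      rw [SimpleGraph.Walk.length_map, hp] at this
      simpa using this
  refine ⟨⟨f.toEquiv.subtypeEquiv fun v => ?_, ?_⟩, hb, fun u => ?_⟩
  · change X.graph.dist X.base v ≤ R ↔ Y.graph.dist Y.base (f v) ≤ R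
    rw [key]
  · intro a b
    exact f.map_rel_iff
  · change dist (X.color (u : X.V)) (Y.color (f u)) < ε
    rwa [hc, dist_self]

end Metric

end PointedColoredGraph

/-- The set of isomorphism classes `[X, x, φ]` of pointed connected graphs with finite vertex
degrees, coloured by `C`. -/
def GromovSpace (C : Type*) : Type _ := Quotient (PointedColoredGraph.setoid C)

namespace GromovSpace

variable {C : Type*}

/-- The class `[X, x, φ]`. -/
def mk (X : PointedColoredGraph C) : GromovSpace C := Quotient.mk _ X

section Topology

variable [PseudoMetricSpace C]

/-- The pairs of classes that are `(R, ε)`-equivalent. -/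
def entourage (C : Type*) [PseudoMetricSpace C] (R : ℕ) (ε : ℝ) :
    Set (GromovSpace C × GromovSpace C) :=
  {p | ∃ X Y : PointedColoredGraph C, mk X = p.1 ∧ mk Y = p.2 ∧ X.DiskEquiv R ε Y}

theorem entourage_mono {r R : ℕ} {δ ε : ℝ} (hr : r ≤ R) (hδ : δ ≤ ε) :
    entourage C R δ ⊆ entourage C r ε := by
  rintro p ⟨X, Y, hX, hY, h⟩
  exact ⟨X, Y, hX, hY, h.mono hr hδ⟩

theorem diskEquiv_of_mem_entourage {R : ℕ} {X Y : PointedColoredGraph C} :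
    (mk X, mk Y) ∈ entourage C (3 * R) (1 / ((3 * R : ℕ) : ℝ)) → 0 < R →
      X.DiskEquiv R (1 / R) Y := by
  rintro ⟨X', Y', hX, hY, h⟩ hR
  have hR' : (0 : ℝ) < R := by exact_mod_cast hR
  have hpos : (0 : ℝ) < 1 / ((3 * R : ℕ) : ℝ) := by push_cast; positivity
  have h1 := PointedColoredGraph.IsIso.diskEquiv (R := 3 * R) hpos (Quotient.exact hX.symm)
  have h2 := PointedColoredGraph.IsIso.diskEquiv (R := 3 * R) hpos (Quotient.exact hY)
  refine ((h1.trans h).trans h2).mono (by omega) (le_of_eq ?_)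
  push_cast
  field_simp
  norm_num

/-- The sets `entourage C R (1 / R)`, `R` a positive integer, form a filter basis. -/
def entourageBasis (C : Type*) [PseudoMetricSpace C] :
    FilterBasis (GromovSpace C × GromovSpace C) where
  sets := {s | ∃ R : ℕ, 0 < R ∧ s = entourage C R (1 / R)}
  nonempty := ⟨_, 1, one_pos, rfl⟩
  inter_sets := by
    rintro _ _ ⟨R, hR, rfl⟩ ⟨S, hS, rfl⟩
    refine ⟨_, ⟨max R S, lt_max_of_lt_left hR, rfl⟩, Set.subset_inter ?_ ?_⟩
    · refine entourage_mono (le_max_left _ _) ?_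
      have : (0 : ℝ) < R := by exact_mod_cast hR
      exact one_div_le_one_div_of_le this (by exact_mod_cast le_max_left R S)
    · refine entourage_mono (le_max_right _ _) ?_
      have : (0 : ℝ) < S := by exact_mod_cast hS
      exact one_div_le_one_div_of_le this (by exact_mod_cast le_max_right R S)

/-- The uniformity on the set of classes with base of entourages `entourage C R (1 / R)`, and its
topology. -/
instance (C : Type*) [PseudoMetricSpace C] : UniformSpace (GromovSpace C) :=
  UniformSpace.ofCore <| UniformSpace.Core.mkOfBasis (entourageBasis C)
    (by
      rintro _ ⟨R, hR, rfl⟩ p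
      induction p using Quotient.inductionOn with | _ X =>
      have hR' : (0 : ℝ) < R := by exact_mod_cast hR
      exact ⟨X, X, rfl, rfl, (PointedColoredGraph.IsIso.refl X).diskEquiv (by positivity)⟩)
    (by
      rintro _ ⟨R, hR, rfl⟩
      refine ⟨_, ⟨R, hR, rfl⟩, ?_⟩
      rintro ⟨p, q⟩ ⟨X, Y, hX, hY, h⟩
      exact ⟨Y, X, hY, hX, h.symm⟩)
    (by
      rintro _ ⟨R, hR, rfl⟩
      refine ⟨_, ⟨3 * (2 * R), by omega, rfl⟩, ?_⟩
      rintro ⟨p, q⟩ ⟨m, h1, h2⟩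
      induction p using Quotient.inductionOn with | _ X =>
      induction q using Quotient.inductionOn with | _ Y =>
      induction m using Quotient.inductionOn with | _ Z =>
      have hR' : (0 : ℝ) < R := by exact_mod_cast hR
      have h1' := diskEquiv_of_mem_entourage h1 (by omega)
      have h2' := diskEquiv_of_mem_entourage h2 (by omega)
      refine ⟨X, Y, rfl, rfl, (h1'.trans h2').mono (by omega) (le_of_eq ?_)⟩
      push_cast
      field_simp
      norm_num)

theorem hasBasis_uniformity (C : Type*) [PseudoMetricSpace C] :
    (uniformity (GromovSpace C)).HasBasis (fun R : ℕ => 0 < R)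
      (fun R => entourage C R (1 / R)) := by
  have h : (uniformity (GromovSpace C)) = (entourageBasis C).filter := rfl
  rw [h]
  refine ⟨fun t => ?_⟩
  rw [FilterBasis.mem_filter_iff]
  constructor
  · rintro ⟨_, ⟨R, hR, rfl⟩, hs⟩
    exact ⟨R, hR, hs⟩
  · rintro ⟨R, hR, hs⟩
    exact ⟨_, ⟨R, hR, rfl⟩, hs⟩

end Topology

end GromovSpace

namespace ColoredGraph

variable {C : Type*}

/-- The canonical map `x ↦ [X, x, φ]`. -/
def leafMap (X : ColoredGraph C) (x : X.V) : GromovSpace C :=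
  GromovSpace.mk { X with base := x }

/-- The subset `[X, φ]` of the space of classes. -/
def leaf (X : ColoredGraph C) : Set (GromovSpace C) := Set.range X.leafMap

def QuasiTransitive (X : ColoredGraph C) : Prop := X.leaf.Finite

/-- The set of classes `[X, x, φ]` such that `(X, φ)` satisfies `P`
(used for isomorphism-invariant `P` only). -/
def classes (P : ColoredGraph C → Prop) : Set (GromovSpace C) :=
  {p | ∃ X : ColoredGraph C, P X ∧ p ∈ X.leaf}

/-- The quasi-transitive classes are dense in the closure of `[X, φ]`. -/
def AlmostChaotic [PseudoMetricSpace C] (X : ColoredGraph C) : Prop :=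
  closure X.leaf ⊆ closure (classes QuasiTransitive ∩ closure X.leaf)

def Chaotic [PseudoMetricSpace C] (X : ColoredGraph C) : Prop :=
  X.AlmostChaotic ∧ X.Aperiodic ∧ ¬ X.QuasiTransitive

end ColoredGraph

namespace GromovSpace

/-- The classes with infinite underlying graph. -/
def infinite (C : Type*) : Set (GromovSpace C) :=
  ColoredGraph.classes fun X => Infinite X.V

/-- The classes with infinite underlying graph of degree at most `Δ`. -/
def infiniteDeg (C : Type*) (Δ : ℕ) : Set (GromovSpace C) :=
  ColoredGraph.classes fun X => Infinite X.V ∧ X.DegreeLE Δ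

end GromovSpace

/-- Graphs without colouring are graphs coloured by a one-point set: isomorphisms and equivalences
of disks then impose no condition on colours. -/
abbrev NoColor : Type := Unit

/-- `S ∩ A` contains a countable intersection of open dense subsets of the subspace `A`. -/
def IsGenericIn {T : Type*} [TopologicalSpace T] (S A : Set T) : Prop :=
  ∃ U : ℕ → Set A, (∀ n, IsOpen (U n) ∧ Dense (U n)) ∧ ⋂ n, U n ⊆ {a : A | (a : T) ∈ S}

theorem PointedColoredGraph.isIso_noColor_iff (X Y : PointedColoredGraph NoColor) :
    X.IsIso Y ↔ ∃ f : X.graph ≃g Y.graph, f X.base = Y.base :=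
  ⟨fun ⟨f, h, _⟩ => ⟨f, h⟩, fun ⟨f, h⟩ => ⟨f, h, fun _ => rfl⟩⟩

theorem PointedColoredGraph.diskEquiv_noColor_iff (X Y : PointedColoredGraph NoColor) (R : ℕ)
    {ε : ℝ} (hε : 0 < ε) :
    X.DiskEquiv R ε Y ↔ ∃ h : X.graph.induce (X.disk R) ≃g Y.graph.induce (Y.disk R),
      (h ⟨X.base, X.base_mem_disk R⟩ : Y.V) = Y.base :=
  ⟨fun ⟨h, hb, _⟩ => ⟨h, hb⟩, fun ⟨h, hb⟩ => ⟨h, hb, fun _ => by simpa using hε⟩⟩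

open Set Filter Topology

/-! ### Disks in locally finite graphs, and how to recognize them -/

namespace PointedColoredGraph

variable {C : Type*}

/-! The heart of (a) is `exists_quasiTransitive_diskEquiv`: for `3 ≤ Δ`, any two disks of infinite
graphs of degree at most `Δ` occur together in one infinite quasi-transitive graph of degree at most
`Δ`. An infinite graph has an edge leaving each disk from a vertex of its bounding sphere.
Redirecting that edge to a node of a line hangs the disk on the line without raising its degrees,
and a node has degree at most three. Hanging the two disks alternately makes the result periodic.

Classes whose leaf meets a given open set form an open set, because one large disk witnesses the
meeting. If the open set meets the subspace, these classes are dense in it: one comb contains both a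
prescribed disk and a disk belonging to the open set. The space is separable with countably
generated uniformity, hence second countable, so a generic leaf is dense in the subspace. The
closure of such a leaf contains all quasi-transitive combs, and these approximate every point of the
leaf; this is almost chaos.

For (b), having distinct colours on the disk of radius `n` is an open condition, and a dense one
because colours in a perfect space can be perturbed apart. Hence the generic colouring is injective,
which rules out nontrivial automorphisms and, the graph being infinite, quasi-transitivity.
Intersecting the two generic sets gives (c). -/

theorem mem_disk_succ_of_adj {X : PointedColoredGraph C} {n : ℕ} {v w : X.V}
    (hv : v ∈ X.disk n) (h : X.graph.Adj v w) : w ∈ X.disk (n + 1) := by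
  have h1 := X.connected.dist_triangle (u := X.base) (v := v) (w := w)
  rw [SimpleGraph.dist_eq_one_iff_adj.2 h] at h1
  exact h1.trans (Nat.add_le_add_right hv 1)

theorem mem_disk_succ {X : PointedColoredGraph C} {n : ℕ} {v : X.V} (hv : v ∈ X.disk (n + 1)) :
    v ∈ X.disk n ∨ ∃ w ∈ X.disk n, X.graph.Adj w v := by
  obtain ⟨p, hp⟩ := X.connected.exists_walk_length_eq_dist v X.base
  cases p with
  | nil => exact .inl (X.base_mem_disk n)
  | cons hadj q =>
    rename_i w
    refine .inr ⟨w, ?_, hadj.symm⟩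
    have hv' : X.graph.dist X.base v ≤ n + 1 := hv
    rw [SimpleGraph.dist_comm, ← hp, SimpleGraph.Walk.length_cons] at hv'
    change X.graph.dist X.base w ≤ n
    have := SimpleGraph.dist_le q
    rw [SimpleGraph.dist_comm]
    omega

theorem mem_disk_zero {X : PointedColoredGraph C} {v : X.V} (hv : v ∈ X.disk 0) : v = X.base :=
  (X.connected.dist_eq_zero_iff.1 (Nat.le_zero.1 hv)).symm

theorem disk_mono (X : PointedColoredGraph C) {r R : ℕ} (h : r ≤ R) : X.disk r ⊆ X.disk R :=
  fun _ hv => le_trans hv h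

theorem finite_disk (X : PointedColoredGraph C) (R : ℕ) : (X.disk R).Finite := by
  induction R with
  | zero => exact (finite_singleton X.base).subset fun v hv => mem_disk_zero hv
  | succ R ih =>
    refine (ih.union (ih.biUnion fun v _ => X.finite_neighborSet v)).subset fun v hv => ?_
    rcases mem_disk_succ hv with h | ⟨w, hw, h⟩
    · exact .inl h
    · exact .inr (mem_biUnion hw h)

/-- An infinite graph leaves every disk through some vertex of its bounding sphere. -/
theorem exists_adj_notMem_disk (X : PointedColoredGraph C) [Infinite X.V] (R : ℕ) :
    ∃ v w, X.graph.dist X.base v = R ∧ X.graph.Adj v w ∧ w ∉ X.disk R := by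
  obtain ⟨z, hz⟩ := (X.finite_disk R).exists_notMem
  obtain ⟨p⟩ := X.connected.preconnected X.base z
  obtain ⟨d, -, h1, h2⟩ := p.exists_boundary_dart (X.disk R) (X.base_mem_disk R) hz
  refine ⟨d.fst, d.snd, le_antisymm h1 ?_, d.adj, h2⟩
  by_contra! h
  refine h2 (X.disk_mono (Nat.succ_le_of_lt h) (mem_disk_succ_of_adj ?_ d.adj))
  exact le_refl (X.graph.dist X.base d.fst)

section Metric

variable [PseudoMetricSpace C]

/-- To recognize a disk it suffices to embed it as an induced subgraph whose interior vertices have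
no further neighbours. -/
theorem diskEquiv_of_embedding {R : ℕ} {ε : ℝ} {X Y : PointedColoredGraph C}
    (f : X.disk R → Y.V) (hinj : Function.Injective f)
    (hadj : ∀ u v, Y.graph.Adj (f u) (f v) ↔ X.graph.Adj (u : X.V) v)
    (hbase : f ⟨X.base, X.base_mem_disk R⟩ = Y.base)
    (hbdry : ∀ (u : X.disk R) w, X.graph.dist X.base (u : X.V) < R → Y.graph.Adj (f u) w → w ∈ range f)
    (hcol : ∀ u : X.disk R, dist (X.color (u : X.V)) (Y.color (f u)) < ε) : X.DiskEquiv R ε Y := by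
  have h1 : ∀ n, ∀ u : X.disk R, (u : X.V) ∈ X.disk n → f u ∈ Y.disk n := by
    intro n
    induction n with
    | zero =>
      intro u hu
      rw [show u = ⟨X.base, X.base_mem_disk R⟩ from Subtype.ext (mem_disk_zero hu), hbase]
      exact Y.base_mem_disk 0
    | succ n ih =>
      intro u hu
      rcases mem_disk_succ hu with h | ⟨w, hw, h⟩
      · exact Y.disk_mono n.le_succ (ih u h)
      · by_cases hn : n ≤ R
        · exact mem_disk_succ_of_adj (ih ⟨w, X.disk_mono hn hw⟩ hw) ((hadj _ _).2 h)
        · exact Y.disk_mono n.le_succ (ih u (X.disk_mono (by omega) u.2))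
  -- Layers of the disk in `Y` are reached one at a time: a vertex of layer `n + 1 ≤ R` has a
  -- neighbour `f u'` with `u'` interior, so `hbdry` applies.
  have h2 : ∀ n ≤ R, ∀ w ∈ Y.disk n, ∃ u : X.disk R, (u : X.V) ∈ X.disk n ∧ f u = w := by
    intro n
    induction n with
    | zero =>
      intro _ w hw
      exact ⟨⟨X.base, X.base_mem_disk R⟩, X.base_mem_disk 0, hbase.trans (mem_disk_zero hw).symm⟩
    | succ n ih =>
      intro hn w hw
      rcases mem_disk_succ hw with h | ⟨w', hw', h⟩
      · obtain ⟨u, hu, rfl⟩ := ih (by omega) w h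
        exact ⟨u, X.disk_mono n.le_succ hu, rfl⟩
      · obtain ⟨u', hu', rfl⟩ := ih (by omega) w' hw'
        obtain ⟨u, rfl⟩ := hbdry u' w (lt_of_le_of_lt hu' hn) h
        exact ⟨u, mem_disk_succ_of_adj hu' ((hadj _ _).1 h), rfl⟩
  have hbij : Function.Bijective
      (fun u : X.disk R => (⟨f u, h1 R u u.2⟩ : Y.disk R)) := by
    refine ⟨fun u v h => hinj (congrArg Subtype.val h), fun w => ?_⟩
    obtain ⟨u, -, hu⟩ := h2 R le_rfl w w.2
    exact ⟨u, Subtype.ext hu⟩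
  exact ⟨⟨Equiv.ofBijective _ hbij, fun {a b} => hadj a b⟩, hbase, hcol⟩

/-- An equivalence of disks restricts to smaller disks around any point. -/
theorem DiskEquiv.exists_rebase {R S : ℕ} {ε : ℝ} {X Y : PointedColoredGraph C}
    (h : X.DiskEquiv (S + R) ε Y) {v : X.V} (hv : v ∈ X.disk S) :
    ∃ w : Y.V, DiskEquiv R ε { X with base := v } { Y with base := w } := by
  obtain ⟨h, hb, hc⟩ := h
  have key : ∀ u ∈ disk { X with base := v } R, u ∈ X.disk (S + R) := fun u hu =>
    X.connected.dist_triangle.trans (add_le_add hv hu)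
  refine ⟨h ⟨v, X.disk_mono (by omega) hv⟩, diskEquiv_of_embedding
    (fun u => (h ⟨u, key u u.2⟩ : Y.V)) (fun u u' huu => ?_) (fun u u' => ?_) rfl
    (fun u w hu hw => ?_) (fun u => hc ⟨u, key u u.2⟩)⟩
  · exact Subtype.ext (Subtype.mk.inj (h.injective (Subtype.ext huu)))
  · exact h.map_rel_iff (a := ⟨u, key u u.2⟩) (b := ⟨u', key u' u'.2⟩)
  · have hu' : X.graph.dist v u < R := hu
    -- An interior vertex of the small disk is interior to the large one, so its neighbours in `Y`
    -- are still in the image of `h`.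
    have h3 : X.graph.dist X.base u ≤ S + R - 1 := by
      have h4 := X.connected.dist_triangle (u := X.base) (v := v) (w := u)
      have h5 : X.graph.dist X.base v ≤ S := hv
      omega
    have h6 : w ∈ Y.disk (S + R) := by
      have := mem_disk_succ_of_adj (dist_le_of_diskIso h hb (S + R - 1) ⟨u, key u u.2⟩ h3) hw
      rwa [show S + R - 1 + 1 = S + R by omega] at this
    obtain ⟨u', hu''⟩ := h.surjective ⟨w, h6⟩
    have hw' : Y.graph.Adj (h ⟨u, key u u.2⟩ : Y.V) (h u' : Y.V) := by rw [hu'']; exact hw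
    have h7 : X.graph.Adj (u : X.V) u' := h.map_rel_iff.1 hw'
    have h8 : (u' : X.V) ∈ disk { X with base := v } R :=
      disk_mono { X with base := v } (Nat.succ_le_of_lt hu')
        (mem_disk_succ_of_adj (X := { X with base := v }) (n := X.graph.dist v u)
          (le_refl (X.graph.dist v u)) h7)
    exact ⟨⟨u', h8⟩, congrArg Subtype.val hu''⟩

end Metric

end PointedColoredGraph

/-! ### Periodic combs

The comb of two disks is a line, subdivided into nodes of two alternating kinds, with a copy of the
disk of the corresponding kind hanging from each node. -/

inductive CombVertex (B : Bool → Type) : Type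
  | node (b : Bool) (n : ℤ) : CombVertex B
  | piece (b : Bool) (n : ℤ) (u : B b) : CombVertex B

namespace CombVertex

variable {B : Bool → Type}

/-- The line runs through `node false n`, `node true n`, `node false (n + 1)`, so that `n` counts
periods. Every edge is listed in both directions. -/
inductive Adj (G : ∀ b, SimpleGraph (B b)) (root : ∀ b, B b) :
    CombVertex B → CombVertex B → Prop
  | inner (b : Bool) (n : ℤ) {u v : B b} (h : (G b).Adj u v) : Adj G root (piece b n u) (piece b n v)
  | up (b : Bool) (n : ℤ) : Adj G root (piece b n (root b)) (node b n)
  | down (b : Bool) (n : ℤ) : Adj G root (node b n) (piece b n (root b))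
  | link (b : Bool) (n : ℤ) : Adj G root (node b n) (node (!b) n)
  | next (n : ℤ) : Adj G root (node true n) (node false (n + 1))
  | prev (n : ℤ) : Adj G root (node false n) (node true (n - 1))

theorem Adj.symm {G : ∀ b, SimpleGraph (B b)} {root : ∀ b, B b} {v w : CombVertex B}
    (h : Adj G root v w) : Adj G root w v := by
  cases h with
  | inner b n h => exact .inner b n h.symm
  | up b n => exact .down b n
  | down b n => exact .up b n
  | link b n => simpa using Adj.link (G := G) (root := root) (!b) n
  | next n => simpa using Adj.prev (G := G) (root := root) (n + 1)
  | prev n => simpa using Adj.next (G := G) (root := root) (n - 1)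

def graph (G : ∀ b, SimpleGraph (B b)) (root : ∀ b, B b) : SimpleGraph (CombVertex B) where
  Adj := Adj G root
  symm := ⟨fun _ _ => Adj.symm⟩
  loopless := ⟨fun v h => by
    generalize hw : v = w at h
    have h' : Adj G root v w := by rw [hw]; exact h
    cases h' <;> simp_all⟩

variable {G : ∀ b, SimpleGraph (B b)} {root : ∀ b, B b}

theorem graph_connected (hG : ∀ b, (G b).Connected) : (graph G root).Connected := by
  have node_succ (n : ℤ) : (graph G root).Reachable (node false n) (node false (n + 1)) :=
    (SimpleGraph.Adj.reachable (Adj.link false n)).trans (SimpleGraph.Adj.reachable (Adj.next n))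
  have node_false (n : ℤ) : (graph G root).Reachable (node false 0) (node false n) := by
    induction n using Int.induction_on with
    | zero => rfl
    | succ n ih => exact ih.trans (node_succ n)
    | pred n ih =>
      refine ih.trans (SimpleGraph.Reachable.symm ?_)
      simpa using node_succ (-(n : ℤ) - 1)
  have node_all (b : Bool) (n : ℤ) : (graph G root).Reachable (node false 0) (node b n) := by
    cases b with
    | false => exact node_false n
    | true => exact (node_false n).trans (SimpleGraph.Adj.reachable (Adj.link false n))
  have all (v : CombVertex B) : (graph G root).Reachable (node false 0) v := by
    cases v with
    | node b n => exact node_all b n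
    | piece b n u =>
      let f : G b →g graph G root := ⟨fun u => piece b n u, fun h => Adj.inner b n h⟩
      exact ((node_all b n).trans (SimpleGraph.Adj.reachable (Adj.down b n))).trans
        (((hG b).preconnected (root b) u).map f)
  have : Nonempty (CombVertex B) := ⟨node false 0⟩
  exact ⟨fun v w => (all v).symm.trans (all w)⟩

/-- Two neighbours on the line and one in the hanging disk: this is the source of the condition `3 ≤
Δ`. -/
theorem neighborSet_node_subset (b : Bool) (n : ℤ) :
    (graph G root).neighborSet (node b n) ⊆
      {piece b n (root b), node (!b) n, node (!b) (if b then n + 1 else n - 1)} := by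
  intro w (h : Adj G root (node b n) w)
  cases h <;> simp

def shift (k : ℤ) : CombVertex B → CombVertex B
  | node b n => node b (n + k)
  | piece b n u => piece b (n + k) u

theorem shift_shift (k l : ℤ) (v : CombVertex B) : shift k (shift l v) = shift (l + k) v := by
  cases v <;> simp [shift, add_assoc]

theorem shift_zero (v : CombVertex B) : shift 0 v = v := by
  cases v <;> simp [shift]

theorem Adj.shift (k : ℤ) {v w : CombVertex B} (h : Adj G root v w) :
    Adj G root (v.shift k) (w.shift k) := by
  cases h with
  | inner b n h => exact .inner b _ h
  | up b n => exact .up b _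
  | down b n => exact .down b _
  | link b n => exact .link b _
  | next n =>
    have := Adj.next (G := G) (root := root) (n + k)
    rwa [add_right_comm] at this
  | prev n =>
    have := Adj.prev (G := G) (root := root) (n + k)
    rwa [add_sub_right_comm] at this

def shiftIso (G : ∀ b, SimpleGraph (B b)) (root : ∀ b, B b) (k : ℤ) :
    graph G root ≃g graph G root where
  toFun := shift k
  invFun := shift (-k)
  left_inv v := by rw [shift_shift, add_neg_cancel, shift_zero]
  right_inv v := by rw [shift_shift, neg_add_cancel, shift_zero]
  map_rel_iff' {v w} := by
    refine ⟨fun h => ?_, fun h => Adj.shift k h⟩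
    have := Adj.shift (-k) (show Adj G root (shift k v) (shift k w) from h)
    rwa [shift_shift, shift_shift, add_neg_cancel, shift_zero, shift_zero] at this

end CombVertex

/-! ### Quasi-transitive models and injective colourings -/

namespace ColoredGraph

variable {C : Type*}

/-- Infinite, with all degrees at most `Δ`; the bound `⊤` is no condition. -/
def InfiniteDegLE (Δ : ℕ∞) (X : ColoredGraph C) : Prop :=
  Infinite X.V ∧ ∀ v, ((X.graph.neighborSet v).ncard : ℕ∞) ≤ Δ

theorem leaf_eq_of_iso {X Y : ColoredGraph C} (f : X.graph ≃g Y.graph)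
    (hf : ∀ v, Y.color (f v) = X.color v) : X.leaf = Y.leaf := by
  have h (x : X.V) : X.leafMap x = Y.leafMap (f x) := Quotient.sound ⟨f, rfl, hf⟩
  ext p
  constructor
  · rintro ⟨x, rfl⟩
    exact ⟨f x, (h x).symm⟩
  · rintro ⟨y, rfl⟩
    exact ⟨f.symm y, (h _).trans (congrArg _ (f.apply_symm_apply y))⟩

theorem InfiniteDegLE.of_iso {Δ : ℕ∞} {X Y : ColoredGraph C} (f : X.graph ≃g Y.graph)
    (h : X.InfiniteDegLE Δ) : Y.InfiniteDegLE Δ := by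
  have := h.1
  refine ⟨Infinite.of_injective f f.injective, fun v => le_trans ?_ (h.2 (f.symm v))⟩
  have : Y.graph.neighborSet v ⊆ f '' X.graph.neighborSet (f.symm v) := by
    intro w hw
    exact ⟨f.symm w, f.symm.map_rel_iff.2 hw, f.apply_symm_apply w⟩
  exact_mod_cast (ncard_le_ncard this ((X.finite_neighborSet _).image _)).trans
    (ncard_image_le (X.finite_neighborSet _))

/-- Any two disks of infinite graphs of degree at most `Δ` occur in one quasi-transitive such
graph. -/
theorem exists_quasiTransitive_diskEquiv [PseudoMetricSpace C] {Δ : ℕ∞} (hΔ : 3 ≤ Δ)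
    (X : Bool → PointedColoredGraph C) (hX : ∀ b, (X b).InfiniteDegLE Δ) (R : Bool → ℕ) :
    ∃ Z : ColoredGraph C, Z.InfiniteDegLE Δ ∧ Z.QuasiTransitive ∧
      ∀ b, ∃ z, ∀ ε > 0, (X b).DiskEquiv (R b) ε { Z with base := z } := by
  have hroot (b : Bool) : ∃ v w, (X b).graph.dist (X b).base v = R b ∧ (X b).graph.Adj v w ∧
      w ∉ (X b).disk (R b) :=
    haveI := (hX b).1
    (X b).exists_adj_notMem_disk (R b)
  choose v w hv hvw hw using hroot
  let B (b : Bool) : Type := (X b).disk (R b)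
  let G (b : Bool) : SimpleGraph (B b) := (X b).graph.induce ((X b).disk (R b))
  let root (b : Bool) : B b := ⟨v b, (hv b).le⟩
  have hB (b : Bool) : Finite (B b) := ((X b).finite_disk (R b)).to_subtype
  have hG (b : Bool) : (G b).Connected := by
    have h : ∀ n, ∀ u : B b, u.1 ∈ (X b).disk n →
        (G b).Reachable ⟨(X b).base, (X b).base_mem_disk _⟩ u := by
      intro n
      induction n with
      | zero =>
        intro u hu
        rw [show u = ⟨(X b).base, (X b).base_mem_disk _⟩ from
          Subtype.ext (PointedColoredGraph.mem_disk_zero hu)]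
      | succ n ih =>
        intro u hu
        rcases PointedColoredGraph.mem_disk_succ hu with h | ⟨w, hw, h⟩
        · exact ih u h
        · by_cases hn : n ≤ R b
          · let w' : B b := ⟨w, (X b).disk_mono hn hw⟩
            have hadj : (G b).Adj w' u := h
            exact (ih w' hw).trans hadj.reachable
          · exact ih u ((X b).disk_mono (by omega) u.2)
    have : Nonempty (B b) := ⟨root b⟩
    exact ⟨fun u u' => (h _ u u.2).symm.trans (h _ u' u'.2)⟩
  classical
  -- The edge from the root to its node replaces the edge to `w b` that leaves the disk, so no
  -- vertex gains degree.
  have hpiece (b : Bool) (n : ℤ) (u : B b) : (CombVertex.graph G root).neighborSet (.piece b n u) ⊆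
      (fun y => if h : y ∈ (X b).disk (R b) then CombVertex.piece (B := B) b n ⟨y, h⟩
        else .node b n) '' (X b).graph.neighborSet u.1 := by
    intro z (hz : CombVertex.Adj G root _ z)
    cases hz with
    | @inner _ _ _ u' h => exact ⟨u'.1, h, dif_pos u'.2⟩
    | up => exact ⟨w b, hvw b, dif_neg (hw b)⟩
  let Z : ColoredGraph C :=
    { V := CombVertex B
      graph := CombVertex.graph G root
      connected := CombVertex.graph_connected hG
      finite_neighborSet := by
        rintro (⟨b, n⟩ | ⟨b, n, u⟩)
        · exact (toFinite _).subset (CombVertex.neighborSet_node_subset b n)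
        · exact (((X b).finite_neighborSet _).image _).subset (hpiece b n u)
      color
        -- Any colour serves here, provided that it is invariant under shifts.
        | .node _ _ => (X false).color (X false).base
        | .piece b _ u => (X b).color u.1 }
  refine ⟨Z, ⟨?_, ?_⟩, ?_, fun b => ⟨.piece b 0 ⟨(X b).base, (X b).base_mem_disk _⟩,
    fun ε hε => ?_⟩⟩
  · exact Infinite.of_injective (fun n : ℤ => CombVertex.node (B := B) false n)
      fun m n h => (CombVertex.node.inj h).2
  · rintro (⟨b, n⟩ | ⟨b, n, u⟩)
    · refine le_trans ?_ hΔ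
      refine (Nat.cast_le.2 (ncard_le_ncard (CombVertex.neighborSet_node_subset b n)
        (toFinite _))).trans ?_
      exact_mod_cast (ncard_insert_le _ _).trans (Nat.succ_le_succ ((ncard_insert_le _ _).trans_eq (by rw [ncard_singleton])))
    · refine le_trans ?_ ((hX b).2 u.1)
      exact_mod_cast (ncard_le_ncard (hpiece b n u) (((X b).finite_neighborSet _).image _)).trans
        (ncard_image_le ((X b).finite_neighborSet _))
  · have hshift (k : ℤ) (z : Z.V) : Z.leafMap (CombVertex.shift k z) = Z.leafMap z := by
      refine (Quotient.sound ⟨CombVertex.shiftIso G root k, rfl, ?_⟩ : Z.leafMap z = _).symm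
      rintro (⟨b, n⟩ | ⟨b, n, u⟩) <;> rfl
    -- One period is a finite fundamental domain for the shifts; `none` stands for the node and
    -- `some u` for a vertex of its disk.
    refine (finite_range fun z : Σ b, Option (B b) =>
      Z.leafMap (z.2.elim (.node z.1 0) (.piece z.1 0))).subset ?_
    rintro _ ⟨⟨b, n⟩ | ⟨b, n, u⟩, rfl⟩
    · refine ⟨⟨b, none⟩, ?_⟩
      simpa [CombVertex.shift] using (hshift n (.node b 0)).symm
    · refine ⟨⟨b, some u⟩, ?_⟩
      simpa [CombVertex.shift] using (hshift n (.piece b 0 u)).symm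
  · refine PointedColoredGraph.diskEquiv_of_embedding
      (fun u : B b => (CombVertex.piece b 0 u : CombVertex B)) (fun u u' h => ?_) (fun u u' => ?_) rfl
      (fun u z hu hz => ?_) (fun u => ?_)
    · injection h
    · constructor
      · intro (h : CombVertex.Adj G root _ _)
        cases h with
        | inner _ _ h => exact h
      · exact fun h => CombVertex.Adj.inner b 0 h
    · have hz' : CombVertex.Adj G root (.piece b 0 u) z := hz
      cases hz' with
      | @inner _ _ _ u' h => exact ⟨u', rfl⟩
      -- Only the root is joined to a node, and it lies at distance exactly `R b`, hence is not
      -- interior.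
      | up => exact absurd (hv b) hu.ne
    · exact (dist_self _).trans_lt hε

/-- A perturbation of the colours that separates the points of a finite set. -/
theorem _root_.Set.Finite.exists_injOn_dist_lt {V Ξ : Type*} [MetricSpace Ξ] [PerfectSpace Ξ]
    {s : Set V} (hs : s.Finite) (φ : V → Ξ) {ε : ℝ} (hε : 0 < ε) :
    ∃ ψ : V → Ξ, InjOn ψ s ∧ ∀ v, dist (φ v) (ψ v) < ε := by
  classical
  induction s, hs using Set.Finite.induction_on with
  | empty => exact ⟨φ, injOn_empty _, fun v => by simpa using hε⟩
  | @insert a s ha hs ih =>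
    obtain ⟨ψ, hψ, hd⟩ := ih
    -- Balls in a perfect metric space are infinite, so some colour near `φ a` is not yet used on
    -- `s`.
    obtain ⟨c, hc, hc'⟩ :=
      ((infinite_of_mem_nhds (φ a) (Metric.ball_mem_nhds _ hε)).sdiff (hs.image ψ)).nonempty
    refine ⟨Function.update ψ a c, ?_, fun v => ?_⟩
    · rw [injOn_insert ha]
      have heq : EqOn (Function.update ψ a c) ψ s := fun v hv =>
        Function.update_of_ne (by rintro rfl; exact ha hv) _ _
      refine ⟨heq.symm.injOn_iff.1 hψ, ?_⟩
      rw [heq.image_eq, Function.update_self]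
      exact hc'
    · by_cases h : v = a
      · subst h
        rw [Function.update_self, dist_comm]
        exact hc
      · rw [Function.update_of_ne h]
        exact hd v

theorem aperiodic_of_injective {X : ColoredGraph C} (h : Function.Injective X.color) :
    X.Aperiodic :=
  fun _ hf v => h (hf v)

/-- A pointed isomorphism carrying `x` to `y` makes their colours equal, so distinct vertices give
distinct classes. -/
theorem not_quasiTransitive_of_injective {X : ColoredGraph C} [Infinite X.V]
    (h : Function.Injective X.color) : ¬ X.QuasiTransitive := by
  refine infinite_range_of_injective fun x y hxy => ?_
  obtain ⟨f, hf, hc⟩ := Quotient.exact hxy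
  have h1 := hc x
  rw [show f x = y from hf] at h1
  exact (h h1).symm

end ColoredGraph

/-! ### Classes, neighbourhoods and residual sets -/

namespace GromovSpace

open ColoredGraph PointedColoredGraph

variable {C : Type*}

theorem leaf_eq_of_mk_eq {X Y : PointedColoredGraph C} (h : mk X = mk Y) : X.leaf = Y.leaf := by
  obtain ⟨f, -, hf⟩ := Quotient.exact h
  exact leaf_eq_of_iso f hf

theorem mk_mem_leaf (X : PointedColoredGraph C) : mk X ∈ X.leaf := ⟨X.base, rfl⟩

theorem mk_mem_classes_infiniteDegLE {Δ : ℕ∞} {X : PointedColoredGraph C} :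
    mk X ∈ classes (InfiniteDegLE Δ) ↔ X.InfiniteDegLE Δ := by
  refine ⟨?_, fun h => ⟨_, h, mk_mem_leaf X⟩⟩
  rintro ⟨Y, hY, y, hy⟩
  obtain ⟨f, -, -⟩ := Quotient.exact hy
  exact InfiniteDegLE.of_iso f hY

theorem isGenericIn_iff_mem_residual {T : Type*} [TopologicalSpace T] {S A : Set T} :
    IsGenericIn S A ↔ {a : A | (a : T) ∈ S} ∈ residual A := by
  constructor
  · rintro ⟨U, hU, hS⟩
    refine mem_of_superset (countable_iInter_mem.2 fun n => ?_) hS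
    exact residual_of_dense_open (hU n).1 (hU n).2
  · intro h
    obtain ⟨s, ho, hd, hc, hs⟩ := mem_residual_iff.1 h
    rcases s.eq_empty_or_nonempty with rfl | hne
    · exact ⟨fun _ => univ, fun _ => ⟨isOpen_univ, dense_univ⟩, by simpa using hs⟩
    · obtain ⟨U, rfl⟩ := hc.exists_eq_range hne
      refine ⟨U, fun n => ⟨ho _ ⟨n, rfl⟩, hd _ ⟨n, rfl⟩⟩, ?_⟩
      rwa [sInter_range] at hs

section Metric

variable [PseudoMetricSpace C]

theorem mem_nhds_mk_iff {X : PointedColoredGraph C} {s : Set (GromovSpace C)} :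
    s ∈ 𝓝 (mk X) ↔ ∃ R : ℕ, 0 < R ∧ ∀ Y, X.DiskEquiv R (1 / R) Y → mk Y ∈ s := by
  rw [(nhds_basis_uniformity' (hasBasis_uniformity C)).mem_iff]
  constructor
  · rintro ⟨R, hR, h⟩
    exact ⟨R, hR, fun Y hY => h ⟨X, Y, rfl, rfl, hY⟩⟩
  · rintro ⟨R, hR, h⟩
    -- Changing representatives at both ends composes three equivalences, whose colour errors of `1
    -- / (3R)` add up to `1 / R`.
    refine ⟨3 * R, by omega, fun q hq => ?_⟩
    induction q using Quotient.inductionOn with | _ Y =>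
    exact h Y (diskEquiv_of_mem_entourage hq hR)

/-- Disks with a common model on an initial segment of `ℕ`, coloured up to a small error, are
equivalent; there are countably many models with colours in a countable dense set. -/
instance separableSpace [TopologicalSpace.SeparableSpace C] :
    TopologicalSpace.SeparableSpace (GromovSpace C) := by
  obtain ⟨s, hs, hsd⟩ := TopologicalSpace.exists_countable_dense C
  have := hs.to_subtype
  let K : Type _ := ℕ × Σ n : ℕ, SimpleGraph (Fin n) × (Fin n → s) × Fin n
  have : Countable K := inferInstance
  let M (k : K) (X : PointedColoredGraph C) : Prop := ∃ e : X.disk k.1 ≃ Fin k.2.1,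
    (∀ u v : X.disk k.1, k.2.2.1.Adj (e u) (e v) ↔ X.graph.Adj (u : X.V) v) ∧
    e ⟨X.base, X.base_mem_disk _⟩ = k.2.2.2.2 ∧
    -- Half of the allowed error, since two graphs will be compared through their common model.
    ∀ u : X.disk k.1, dist (X.color (u : X.V)) (k.2.2.2.1 (e u)) < 1 / k.1 / 2
  have hM {R : ℕ} (hR : 0 < R) (X : PointedColoredGraph C) : ∃ k : K, k.1 = R ∧ M k X := by
    have := (X.finite_disk R).to_subtype
    have hR' : (0 : ℝ) < 1 / R / 2 := by positivity
    obtain ⟨n, ⟨e⟩⟩ := Finite.exists_equiv_fin (X.disk R)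
    have hc (i : Fin n) : ∃ c : s, dist (X.color (e.symm i : X.V)) c < 1 / R / 2 := by
      obtain ⟨c, hc, h⟩ := hsd.exists_dist_lt (X.color (e.symm i : X.V)) hR'
      exact ⟨⟨c, hc⟩, h⟩
    choose c hc using hc
    refine ⟨⟨R, n, (X.graph.induce (X.disk R)).map e.toEmbedding, c,
      e ⟨X.base, X.base_mem_disk R⟩⟩, rfl, e, fun u v => ?_, rfl, fun u => ?_⟩
    · exact SimpleGraph.map_adj_apply (f := e.toEmbedding)
    · simpa using hc (e u)
  have hMM {k : K} {X Y : PointedColoredGraph C} (hX : M k X) (hY : M k Y) :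
      X.DiskEquiv k.1 (1 / k.1) Y := by
    obtain ⟨e, he, hb, hc⟩ := hX
    obtain ⟨e', he', hb', hc'⟩ := hY
    refine ⟨⟨e.trans e'.symm, fun {u v} => ?_⟩, ?_, fun u => ?_⟩
    · change Y.graph.Adj (e'.symm (e u) : Y.V) (e'.symm (e v)) ↔ X.graph.Adj (u : X.V) v
      rw [← he', ← he, e'.apply_symm_apply, e'.apply_symm_apply]
    · change (e'.symm (e _) : Y.V) = Y.base
      rw [hb, ← hb', e'.symm_apply_apply]
    · have h := hc' (e'.symm (e u))
      rw [e'.apply_symm_apply, dist_comm] at h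
      calc _ ≤ _ := dist_triangle _ _ _
        _ < 1 / k.1 / 2 + 1 / k.1 / 2 := add_lt_add (hc u) h
        _ = _ := add_halves _
  refine ⟨range fun k : {k : K // ∃ X, M k X} => mk k.2.choose, countable_range _, fun p => ?_⟩
  induction p using Quotient.inductionOn with | _ X =>
  refine mem_closure_iff_nhds.2 fun t ht => ?_
  obtain ⟨R, hR, h⟩ := mem_nhds_mk_iff.1 ht
  obtain ⟨k, rfl, hk⟩ := hM hR X
  exact ⟨_, h _ (hMM hk (Exists.choose_spec ⟨X, hk⟩)), ⟨k, X, hk⟩, rfl⟩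

/-- The disk around `x` that certifies membership in `O` lies in a larger disk around the base
point, and any graph sharing that larger disk has a corresponding point. -/
theorem isOpen_leaf_inter_nonempty {O : Set (GromovSpace C)} (hO : IsOpen O) :
    IsOpen {p | ∃ X : PointedColoredGraph C, mk X = p ∧ (X.leaf ∩ O).Nonempty} := by
  rw [isOpen_iff_mem_nhds]
  rintro _ ⟨X, rfl, _, ⟨x, rfl⟩, hx⟩
  obtain ⟨R, hR, h⟩ := mem_nhds_mk_iff.1 (hO.mem_nhds hx)
  refine mem_nhds_mk_iff.2 ⟨X.graph.dist X.base x + R, by omega, fun Y hY => ?_⟩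
  obtain ⟨y, hy⟩ := (hY.mono le_rfl (one_div_le_one_div_of_le (by exact_mod_cast hR)
    (by exact_mod_cast Nat.le_add_left _ _) : _ ≤ 1 / (R : ℝ))).exists_rebase
    (le_refl (X.graph.dist X.base x))
  exact ⟨Y, rfl, _, ⟨y, rfl⟩, h _ hy⟩

/-- The generic leaf is dense. -/
theorem eventually_residual_subset_closure_leaf [TopologicalSpace.SeparableSpace C] {Δ : ℕ∞}
    (hΔ : 3 ≤ Δ) : ∀ᶠ p : classes (InfiniteDegLE (C := C) Δ) in residual _,
      ∀ X : PointedColoredGraph C, mk X = p → classes (InfiniteDegLE Δ) ⊆ closure X.leaf := by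
  have : (uniformity (GromovSpace C)).IsCountablyGenerated :=
    (hasBasis_uniformity C).isCountablyGenerated
  have : SecondCountableTopology (GromovSpace C) :=
    UniformSpace.secondCountable_of_separable _
  have key (O : Set (GromovSpace C)) (hO : IsOpen O)
      (hne : (O ∩ classes (InfiniteDegLE Δ)).Nonempty) :
      ∀ᶠ p : classes (InfiniteDegLE (C := C) Δ) in residual _,
        ∃ X : PointedColoredGraph C, mk X = p ∧ (X.leaf ∩ O).Nonempty := by
    refine residual_of_dense_open
      ((isOpen_leaf_inter_nonempty hO).preimage continuous_subtype_val) ?_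
    rintro ⟨p, hp⟩
    refine mem_closure_iff_nhds.2 fun t ht => ?_
    obtain ⟨u, hu, hut⟩ := mem_nhds_subtype _ _ _ |>.1 ht
    obtain ⟨q, hqO, hq⟩ := hne
    induction p using Quotient.inductionOn with | _ X =>
    induction q using Quotient.inductionOn with | _ Y =>
    obtain ⟨R, hR, h⟩ := mem_nhds_mk_iff.1 hu
    obtain ⟨S, hS, h'⟩ := mem_nhds_mk_iff.1 (hO.mem_nhds hqO)
    -- The comb of both disks, based in a copy of the first, is close to `X`, while the copy of the
    -- second makes its leaf meet `O`.
    obtain ⟨Z, hZ, -, hz⟩ := exists_quasiTransitive_diskEquiv hΔ (fun b => bif b then X else Y)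
      (by
        rintro (_ | _)
        · exact mk_mem_classes_infiniteDegLE.1 hq
        · exact mk_mem_classes_infiniteDegLE.1 hp) (fun b => bif b then R else S)
    obtain ⟨x, hx⟩ := hz true
    obtain ⟨y, hy⟩ := hz false
    exact ⟨⟨Z.leafMap x, Z, hZ, x, rfl⟩, hut (h _ (hx _ (by positivity))),
      _, rfl, _, ⟨y, rfl⟩, h' _ (hy _ (by positivity))⟩
  have hall : ∀ᶠ p : classes (InfiniteDegLE (C := C) Δ) in residual _,
      ∀ O ∈ TopologicalSpace.countableBasis (GromovSpace C),
        (O ∩ classes (InfiniteDegLE Δ)).Nonempty →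
        ∃ X : PointedColoredGraph C, mk X = p ∧ (X.leaf ∩ O).Nonempty := by
    refine (eventually_countable_ball (TopologicalSpace.countable_countableBasis _)).2
      fun O hO => ?_
    by_cases hne : (O ∩ classes (InfiniteDegLE (C := C) Δ)).Nonempty
    · filter_upwards [key O (TopologicalSpace.isOpen_of_mem_countableBasis hO) hne] with p hp _
      exact hp
    · exact .of_forall fun p h => absurd h hne
  filter_upwards [hall] with p hp X hX q hq
  refine (TopologicalSpace.isBasis_countableBasis _).mem_closure_iff.2 fun O hO hqO => ?_
  obtain ⟨Y, hY, h⟩ := hp O hO ⟨q, hqO, hq⟩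
  rwa [inter_comm, leaf_eq_of_mk_eq (hX.trans hY.symm)]

/-- The combs approximating points of the leaf lie in the subspace, hence in the closure of the leaf
once the leaf is dense there. -/
theorem eventually_residual_almostChaotic [TopologicalSpace.SeparableSpace C] {Δ : ℕ∞}
    (hΔ : 3 ≤ Δ) : ∀ᶠ p : classes (InfiniteDegLE (C := C) Δ) in residual _,
      ∀ X : PointedColoredGraph C, mk X = p → X.AlmostChaotic := by
  filter_upwards [eventually_residual_subset_closure_leaf hΔ] with p hp X hX
  have hXΔ : X.InfiniteDegLE Δ := mk_mem_classes_infiniteDegLE.1 (hX ▸ p.2)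
  refine closure_minimal ?_ isClosed_closure
  rintro _ ⟨x, rfl⟩
  refine mem_closure_iff_nhds.2 fun t ht => ?_
  obtain ⟨R, hR, h⟩ := mem_nhds_mk_iff.1 ht
  -- Here a single disk has to be reproduced, so it is used for both kinds of node.
  obtain ⟨Z, hZ, hqt, hz⟩ :=
    exists_quasiTransitive_diskEquiv hΔ (fun _ => { X with base := x }) (fun _ => hXΔ) fun _ => R
  obtain ⟨z, hz⟩ := hz true
  exact ⟨Z.leafMap z, h _ (hz _ (by positivity)), ⟨Z, hqt, z, rfl⟩, hp X hX ⟨Z, hZ, z, rfl⟩⟩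

end Metric

/-! ### Generic colourings are injective -/

section Perfect

variable {Ξ : Type*} [MetricSpace Ξ]

/-- The disk is finite, so its colours have a positive minimal separation; errors below half of it
cannot make two of them coincide. -/
theorem exists_forall_diskEquiv_injOn {X : PointedColoredGraph Ξ} {n : ℕ}
    (h : InjOn X.color (X.disk n)) :
    ∃ ε > 0, ∀ Y, X.DiskEquiv n ε Y → InjOn Y.color (Y.disk n) := by
  have hfin := X.finite_disk n
  have h1 : ∀ᶠ ε in 𝓝[>] (0 : ℝ), ∀ u ∈ X.disk n, ∀ v ∈ X.disk n, u ≠ v →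
      ε + ε < dist (X.color u) (X.color v) := by
    refine (eventually_all_finite hfin).2 fun u hu => (eventually_all_finite hfin).2 fun v hv => ?_
    by_cases huv : u = v
    · exact .of_forall fun _ h => absurd huv h
    · have h0 : 0 < dist (X.color u) (X.color v) := dist_pos.2 fun h' => huv (h hu hv h')
      have h2 : Tendsto (fun ε : ℝ => ε + ε) (𝓝 0) (𝓝 0) :=
        (continuous_id.add continuous_id).tendsto' 0 0 (by simp)
      filter_upwards [nhdsWithin_le_nhds (h2.eventually_lt_const h0)] with ε hε _
      exact hε
  obtain ⟨ε, hε, hε0⟩ := (h1.and self_mem_nhdsWithin).exists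
  refine ⟨ε, hε0, fun Y hY => ?_⟩
  obtain ⟨f, -, hf⟩ := hY.symm
  intro u hu v hv huv
  by_contra hne
  have h3 : (f ⟨u, hu⟩ : X.V) ≠ f ⟨v, hv⟩ := fun h' =>
    hne (congrArg Subtype.val (f.injective (Subtype.ext h')))
  have h4 := hε _ (f ⟨u, hu⟩).2 _ (f ⟨v, hv⟩).2 h3
  have h5 := hf ⟨u, hu⟩
  have h6 := hf ⟨v, hv⟩
  have h7 := dist_triangle_left (X.color (f ⟨u, hu⟩)) (X.color (f ⟨v, hv⟩)) (Y.color u)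
  simp only [huv] at h5 h7
  linarith

theorem eventually_residual_injective_color [PerfectSpace Ξ] (Δ : ℕ∞) :
    ∀ᶠ p : classes (InfiniteDegLE (C := Ξ) Δ) in residual _,
      ∀ X : PointedColoredGraph Ξ, mk X = p → Function.Injective X.color := by
  have key (n : ℕ) : ∀ᶠ p : classes (InfiniteDegLE (C := Ξ) Δ) in residual _,
      ∃ X : PointedColoredGraph Ξ, mk X = p ∧ InjOn X.color (X.disk n) := by
    refine residual_of_dense_open (IsOpen.preimage continuous_subtype_val
      (t := {p | ∃ X : PointedColoredGraph Ξ, mk X = p ∧ InjOn X.color (X.disk n)}) ?_) ?_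
    · rw [isOpen_iff_mem_nhds]
      rintro _ ⟨X, rfl, hX⟩
      obtain ⟨ε, hε, h⟩ := exists_forall_diskEquiv_injOn hX
      obtain ⟨m, hm⟩ := exists_nat_one_div_lt hε
      refine mem_nhds_mk_iff.2 ⟨max n (m + 1), by omega, fun Y hY => ⟨Y, rfl, h Y ?_⟩⟩
      refine hY.mono (le_max_left _ _) (le_trans ?_ hm.le)
      refine one_div_le_one_div_of_le (by positivity) ?_
      exact_mod_cast le_max_right n (m + 1)
    · rintro ⟨p, hp⟩
      refine mem_closure_iff_nhds.2 fun t ht => ?_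
      obtain ⟨u, hu, hut⟩ := mem_nhds_subtype _ _ _ |>.1 ht
      induction p using Quotient.inductionOn with | _ X =>
      obtain ⟨R, hR, h⟩ := mem_nhds_mk_iff.1 hu
      -- Density: the graph is kept and only the colours are perturbed, which preserves the degree
      -- bound.
      obtain ⟨ψ, hψ, hd⟩ := (X.finite_disk n).exists_injOn_dist_lt X.color
        (show (0 : ℝ) < 1 / R by positivity)
      let Y : PointedColoredGraph Ξ := { X with color := ψ }
      have hY : Y.InfiniteDegLE Δ := (mk_mem_classes_infiniteDegLE (X := X)).1 hp
      exact ⟨⟨mk Y, mk_mem_classes_infiniteDegLE.2 hY⟩,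
        hut (h Y ⟨SimpleGraph.Iso.refl, rfl, fun u => hd u⟩), Y, rfl, hψ⟩
  filter_upwards [eventually_countable_forall.2 key] with p hp X hX
  intro u v huv
  -- Any two vertices lie in a common disk. Injectivity is known for some representative `Y` and
  -- passes to `X` because isomorphic graphs are equivalent for every error.
  obtain ⟨Y, hY, hinj⟩ := hp (max (X.graph.dist X.base u) (X.graph.dist X.base v))
  obtain ⟨ε, hε, h⟩ := exists_forall_diskEquiv_injOn hinj
  exact h X ((Quotient.exact (hY.trans hX.symm) : Y.IsIso X).diskEquiv hε)
    (le_max_left (X.graph.dist X.base u) _) (le_max_right _ (X.graph.dist X.base v)) huv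

end Perfect

/-- Requiring `P` of every representative avoids proving that `P` is invariant under isomorphism. -/
theorem isGenericIn_classes {P : ColoredGraph C → Prop} [PseudoMetricSpace C]
    {A : Set (GromovSpace C)} (h : ∀ᶠ p : A in residual A, ∀ X, mk X = p → P X.toColoredGraph) :
    IsGenericIn (classes P) A := by
  refine isGenericIn_iff_mem_residual.2 (mem_of_superset h ?_)
  rintro ⟨p, hp⟩ h
  induction p using Quotient.inductionOn with | _ X =>
  exact ⟨_, h X rfl, mk_mem_leaf X⟩

/-! ### Generic properties with and without degree bound -/

theorem infinite_eq (C : Type*) : infinite C = classes (InfiniteDegLE ⊤) := by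
  simp [infinite, InfiniteDegLE, classes]

theorem infiniteDeg_eq (C : Type*) (Δ : ℕ) : infiniteDeg C Δ = classes (InfiniteDegLE Δ) := by
  simp [infiniteDeg, InfiniteDegLE, DegreeLE, classes]

theorem isGenericIn_almostChaotic [PseudoMetricSpace C] [TopologicalSpace.SeparableSpace C]
    {Δ : ℕ∞} (hΔ : 3 ≤ Δ) :
    IsGenericIn (classes AlmostChaotic) (classes (InfiniteDegLE (C := C) Δ)) :=
  isGenericIn_classes (eventually_residual_almostChaotic hΔ)

variable {Ξ : Type*} [MetricSpace Ξ] [PerfectSpace Ξ]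

theorem isGenericIn_aperiodic (Δ : ℕ∞) :
    IsGenericIn (classes Aperiodic) (classes (InfiniteDegLE (C := Ξ) Δ)) := by
  refine isGenericIn_classes ?_
  filter_upwards [eventually_residual_injective_color Δ] with p hp X hX
  exact aperiodic_of_injective (hp X hX)

theorem isGenericIn_chaotic [TopologicalSpace.SeparableSpace Ξ] {Δ : ℕ∞} (hΔ : 3 ≤ Δ) :
    IsGenericIn (classes Chaotic) (classes (InfiniteDegLE (C := Ξ) Δ)) := by
  refine isGenericIn_classes ?_
  filter_upwards [eventually_residual_injective_color Δ, eventually_residual_almostChaotic hΔ]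
    with p hp hp' X hX
  have : Infinite X.V := (mk_mem_classes_infiniteDegLE.1 (hX ▸ p.2 : mk X ∈ _)).1
  exact ⟨hp' X hX, aperiodic_of_injective (hp X hX), not_quasiTransitive_of_injective (hp X hX)⟩

end GromovSpace

theorem theorem1p1 {Ξ : Type*} [MetricSpace Ξ] [IsUltrametricDist Ξ] [CompactSpace Ξ]
    [PerfectSpace Ξ] [Nonempty Ξ] :
    -- (a) almost chaotic classes, uncoloured and coloured
    (IsGenericIn (ColoredGraph.classes ColoredGraph.AlmostChaotic)
        (GromovSpace.infinite NoColor) ∧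
      (∀ Δ : ℕ, 3 ≤ Δ → IsGenericIn (ColoredGraph.classes ColoredGraph.AlmostChaotic)
        (GromovSpace.infiniteDeg NoColor Δ)) ∧
      IsGenericIn (ColoredGraph.classes ColoredGraph.AlmostChaotic)
        (GromovSpace.infinite Ξ) ∧
      (∀ Δ : ℕ, 3 ≤ Δ → IsGenericIn (ColoredGraph.classes ColoredGraph.AlmostChaotic)
        (GromovSpace.infiniteDeg Ξ Δ))) ∧
    -- (b) aperiodic classes
    (IsGenericIn (ColoredGraph.classes ColoredGraph.Aperiodic) (GromovSpace.infinite Ξ) ∧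
      (∀ Δ : ℕ, IsGenericIn (ColoredGraph.classes ColoredGraph.Aperiodic)
        (GromovSpace.infiniteDeg Ξ Δ))) ∧
    -- (c) chaotic classes
    (IsGenericIn (ColoredGraph.classes ColoredGraph.Chaotic) (GromovSpace.infinite Ξ) ∧
      (∀ Δ : ℕ, 3 ≤ Δ → IsGenericIn (ColoredGraph.classes ColoredGraph.Chaotic)
        (GromovSpace.infiniteDeg Ξ Δ))) := by
  have h3 {Δ : ℕ} (h : 3 ≤ Δ) : (3 : ℕ∞) ≤ Δ := by exact_mod_cast h
  simp only [GromovSpace.infinite_eq, GromovSpace.infiniteDeg_eq]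
  -- A one-point colour space is separable, so the uncoloured case is an instance of the coloured
  -- one; the bound `⊤` gives the spaces of unrestricted degree.
  exact ⟨⟨GromovSpace.isGenericIn_almostChaotic le_top,
      fun _ h => GromovSpace.isGenericIn_almostChaotic (h3 h),
      GromovSpace.isGenericIn_almostChaotic le_top,
      fun _ h => GromovSpace.isGenericIn_almostChaotic (h3 h)⟩,
    ⟨GromovSpace.isGenericIn_aperiodic ⊤, fun Δ => GromovSpace.isGenericIn_aperiodic Δ⟩,
    GromovSpace.isGenericIn_chaotic le_top,
    fun _ h => GromovSpace.isGenericIn_chaotic (h3 h)⟩
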